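/- Let $M$ be a compact smooth manifold without boundary of dimension $n\ge 2$ with a smooth Riemannian metric $g_0$, Laplacian $\Delta_0$ and volume $V_0=\mathrm{vol}(M,g_0)$. Let $\varphi_0,\varphi_1,\varphi_2,\dots$ be an orthonormal basis of $L^2(M,dV_{g_0})$ consisting of smooth eigenfunctions, $-\Delta_0\varphi_j=\lambda_j\varphi_j$, with $\lambda_0=0$ and $\varphi_0$ constant. Let $c_j=F(\lambda_j)>0$ for $j\ge 1$, where $F:\mathbb{R}\to\mathbb{R}$ is eventually monotone decreasing and $F(t)\to 0$ as $t\to\infty$. Let $a_1,a_2,\dots$ be independent standard Gaussian random variables on a probability space, and let $f$ be the random field $$f(x)=-\sum_{j=1}^\infty a_jc_j\varphi_j(x),\qquad x\in M,$$ where for every $x\in M$ the series converges to $f(x)$ almost surely, and where $f$ is almost surely a continuous function on $M$ (for instance, almost surely $C^2$). For $a\in\mathbb{R}$ let $V_1(a)=\mathrm{vol}(M,e^{af}g_0)$ be the volume of the random metric $e^{af}g_0$. Then $V_0<\infty$, each $V_1(a)$ is a random variable with finite expectation (measurable after completion of the probability space), and $$\lim_{a\to 0}\mathbb{E}[V_1(a)]=V_0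 .$$ -/

import Mathlib

open MeasureTheory ProbabilityTheory Filter Topology Bundle
open scoped Manifold ContDiff

noncomputable section

namespace RandomMetric

/-- Euclidean space of dimension `n`, the model of the manifolds below. -/
abbrev Eucl (n : ℕ) : Type := EuclideanSpace ℝ (Fin n)

/-- Riemannian metrics on `M`, with no regularity required in the base point. -/
abbrev RMetric (n : ℕ) (M : Type*) [TopologicalSpace M] [ChartedSpace (Eucl n) M] :=
  RiemannianMetric (fun x : M => TangentSpace (𝓡 n) x)

/-- Smooth Riemannian metrics on `M`. -/
abbrev SmoothMetric (n : ℕ) (M : Type*) [TopologicalSpace M] [ChartedSpace (Eucl n) M]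
    [IsManifold (𝓡 n) ∞ M] :=
  haveI : IsManifold (𝓡 n) 1 M := IsManifold.of_le (n := ∞) (by norm_num)
  ContMDiffRiemannianMetric (𝓡 n) ∞ (Eucl n) (fun x : M => TangentSpace (𝓡 n) x)

section Geometry

variable {n : ℕ} {M : Type*} [TopologicalSpace M] [ChartedSpace (Eucl n) M]

/-- The Riemannian metric underlying a smooth Riemannian metric. -/
def SmoothMetric.toRMetric [IsManifold (𝓡 n) ∞ M] (g : SmoothMetric n M) : RMetric n M :=
  haveI : IsManifold (𝓡 n) 1 M := IsManifold.of_le (n := ∞) (by norm_num)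
  ContMDiffRiemannianMetric.toRiemannianMetric g

/-- The conformal metric `e ^ u • g`. -/
def conformal (g : RMetric n M) (u : M → ℝ) : RMetric n M where
  inner x := Real.exp (u x) • g.inner x
  symm x v w := by simp [g.symm x v w]
  pos x v hv := by
    have := g.pos x v hv
    simp only [smul_apply, smul_eq_mul]
    positivity
  continuousAt x := by
    exact (g.continuousAt x).const_smul (Real.exp (u x))
  isVonNBounded x := by
    have h := (g.isVonNBounded x).image
      ((Real.exp (-(u x) / 2)) • ContinuousLinearMap.id ℝ (TangentSpace (𝓡 n) x))
    refine h.subset ?_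
    intro v hv
    have e1 : Real.exp (u x / 2) * Real.exp (u x / 2) = Real.exp (u x) := by
      rw [← Real.exp_add]; ring_nf
    have e2 : Real.exp (-(u x) / 2) * Real.exp (u x / 2) = 1 := by
      rw [← Real.exp_add]; ring_nf; simp
    refine ⟨Real.exp (u x / 2) • v, ?_, ?_⟩
    · simp only [Set.mem_ofPred_eq, smul_apply, smul_eq_mul, map_smul] at hv ⊢
      rwa [← mul_assoc, e1]
    · simp [smul_smul, mul_comm (Real.exp (u x / 2)), e2]

/-- The coordinate vector field `∂ᵢ` of the chart at `p`, at the point with coordinates `y`. -/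
def coordVec (p : M) (y : Eucl n) (i : Fin n) :
    TangentSpace (𝓡 n) ((chartAt (Eucl n) p).symm y) :=
  mfderiv 𝓘(ℝ, Eucl n) (𝓡 n) (chartAt (Eucl n) p).symm y (EuclideanSpace.single i (1 : ℝ))

/-- The matrix `g_{ij}` of the metric in the chart at `p`, at the point with coordinates `y`. -/
def gram (g : RMetric n M) (p : M) (y : Eucl n) : Matrix (Fin n) (Fin n) ℝ :=
  Matrix.of fun i j =>
    g.inner ((chartAt (Eucl n) p).symm y) (coordVec p y i) (coordVec p y j)

/-- The Laplace–Beltrami operator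
`Δ u = (det g)^{-1/2} ∑ᵢ ∂ᵢ ((det g)^{1/2} ∑ⱼ g^{ij} ∂ⱼ u)`,
computed at each point in the preferred chart at that point. -/
def laplacian (g : RMetric n M) (u : M → ℝ) (x : M) : ℝ :=
  (√(gram g x (chartAt (Eucl n) x x)).det)⁻¹ *
    ∑ i, fderiv ℝ
      (fun y => √(gram g x y).det * ∑ j, (gram g x y)⁻¹ i j *
        fderiv ℝ (u ∘ (chartAt (Eucl n) x).symm) y (EuclideanSpace.single j (1 : ℝ)))
      (chartAt (Eucl n) x x) (EuclideanSpace.single i (1 : ℝ))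

variable [IsManifold (𝓡 n) ∞ M] [CompactSpace M] [T2Space M]

variable (n M) in
/-- A smooth partition of unity subordinate to the domains of the charts. -/
def chartPartition : SmoothPartitionOfUnity M (𝓡 n) M Set.univ :=
  (SmoothPartitionOfUnity.exists_isSubordinate_chartAt_source (𝓡 n) M).choose

variable [MeasurableSpace M]

/-- The Riemannian volume measure `dV_g`: in coordinates it is `(det g)^{1/2} dy`, and the local
expressions are glued with a partition of unity. -/
def vol (g : RMetric n M) : Measure M :=
  Measure.sum fun p : M =>
    (((volume : Measure (Eucl n)).restrict (chartAt (Eucl n) p).target).withDensity fun y =>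
      ENNReal.ofReal (chartPartition n M p ((chartAt (Eucl n) p).symm y) *
        √(gram g p y).det)).map (chartAt (Eucl n) p).symm

/-- `φ₀, φ₁, …` is an orthonormal basis of `L²(M, dV_g)` that consists of smooth eigenfunctions,
`-Δ φⱼ = lam j φⱼ`, where `lam 0 = 0` and `φ₀` is constant. -/
structure IsEigenbasis (g : RMetric n M) (lam : ℕ → ℝ) (φ : ℕ → M → ℝ) : Prop where
  smooth : ∀ j, ContMDiff (𝓡 n) 𝓘(ℝ, ℝ) ∞ (φ j)
  eigen : ∀ j x, -laplacian g (φ j) x = lam j * φ j x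
  lam_zero : lam 0 = 0
  const_zero : ∀ x y, φ 0 x = φ 0 y
  basis : ∃ b : HilbertBasis ℕ ℝ (Lp ℝ 2 (vol g)), ∀ j, (b j : M → ℝ) =ᵐ[vol g] φ j

end Geometry

/-- `f` is the random field `f(x) = -∑_{j ≥ 1} a_j c_j φ_j(x)`: the series converges to `f(x)`
almost surely, for every `x`. -/
def IsRandomSeries {Ω M : Type*} [MeasurableSpace Ω] (P : Measure Ω) (a : ℕ → Ω → ℝ)
    (c : ℕ → ℝ) (φ : ℕ → M → ℝ) (f : Ω → M → ℝ) : Prop :=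
  ∀ x, ∀ᵐ w ∂P, Tendsto
    (fun N : ℕ => -∑ j ∈ Finset.Icc 1 N, a j w * c j * φ j x) atTop (𝓝 (f w x))

end RandomMetric

end

/-! A conformal factor `e^{tf}` multiplies the volume density by `e^{ntf/2}` (`vol_conformal_univ`),
so Tonelli gives `E[V₁(t)] = ∫ exp(n²t²v(x)/8) dV₀(x)`, where `v(x)` is the variance of `f(x)`.

The key point is that `v` is bounded (`exists_variance_bound`). Each `f(x)` is an almost sure limit
of centred Gaussians, hence centred Gaussian. Almost sure continuity of `f` gives almost sure
convergence along convergent sequences of points, and for centred Gaussians this forces the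
variances to converge (`exists_hasLaw_gaussianReal_of_tendsto`). Thus `v` is continuous on the
compact `M`; no eigenvalue asymptotics enter. Since `vol M` is finite, all exponential moments are
finite on `Ω × M`, and dominated convergence gives the limit. -/

namespace RandomMetric

open scoped NNReal ENNReal

/-! ### Limits of centred Gaussian variables -/

section Gaussian

variable {Ω : Type*} [MeasurableSpace Ω] {P : Measure Ω}

lemma charFun_gaussianReal_zero (v : ℝ≥0) (s : ℝ) :
    charFun (gaussianReal 0 v) s = (Real.exp (-(v * s ^ 2 / 2)) : ℝ) := by
  rw [charFun_gaussianReal]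
  push_cast
  congr 1
  ring

/-- Almost sure convergence implies pointwise convergence of the characteristic functions. -/
lemma tendsto_charFun_map [IsProbabilityMeasure P] {X : ℕ → Ω → ℝ} {Y : Ω → ℝ}
    (hX : ∀ k, AEMeasurable (X k) P)
    (h : ∀ᵐ w ∂P, Tendsto (fun k => X k w) atTop (𝓝 (Y w))) (s : ℝ) :
    Tendsto (fun k => charFun (P.map (X k)) s) atTop (𝓝 (charFun (P.map Y) s)) := by
  have hY : AEMeasurable Y P := aemeasurable_of_tendsto_metrizable_ae' hX h
  have hexp : ∀ {Z : Ω → ℝ}, AEMeasurable Z P →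
      charFun (P.map Z) s = ∫ w, Complex.exp (s * Z w * Complex.I) ∂P := by
    intro Z hZ
    rw [charFun_apply_real, integral_map hZ]
    exact Continuous.aestronglyMeasurable (by fun_prop)
  simp_rw [hexp hY, hexp (hX _)]
  refine tendsto_integral_of_dominated_convergence (fun _ => 1) (fun k => ?_)
    (integrable_const 1) (fun k => ?_) ?_
  · have := hX k
    exact AEMeasurable.aestronglyMeasurable (by fun_prop)
  · refine ae_of_all _ fun w => ?_
    rw [← Complex.ofReal_mul, Complex.norm_exp_ofReal_mul_I]
  · filter_upwards [h] with w hw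
    have : Continuous fun r : ℝ => Complex.exp (s * r * Complex.I) := by fun_prop
    exact (this.tendsto _).comp hw

/-- The variances of an almost surely convergent sequence of centred Gaussian variables converge,
and the limit is a centred Gaussian variable with the limiting variance. -/
lemma exists_hasLaw_gaussianReal_of_tendsto [IsProbabilityMeasure P] {X : ℕ → Ω → ℝ} {Y : Ω → ℝ}
    {v : ℕ → ℝ≥0} (hX : ∀ k, HasLaw (X k) (gaussianReal 0 (v k)) P)
    (h : ∀ᵐ w ∂P, Tendsto (fun k => X k w) atTop (𝓝 (Y w))) :
    ∃ u, Tendsto v atTop (𝓝 u) ∧ HasLaw Y (gaussianReal 0 u) P := by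
  have hXm := fun k => (hX k).aemeasurable
  have hY : AEMeasurable Y P := aemeasurable_of_tendsto_metrizable_ae' hXm h
  have : IsProbabilityMeasure (P.map Y) := Measure.isProbabilityMeasure_map hY
  have hlim := tendsto_charFun_map hXm h
  simp_rw [(hX _).map_eq, charFun_gaussianReal_zero] at hlim
  -- The limit characteristic function is continuous and equals 1 at 0, so it is nonzero at some `s
  -- ≠ 0`. There the logarithm of its modulus determines the limit of the variances, which therefore
  -- cannot escape to infinity.
  obtain ⟨s, hs, hs0⟩ : ∃ s : ℝ, charFun (P.map Y) s ≠ 0 ∧ s ≠ 0 := by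
    have hc : ∀ᶠ s in 𝓝 (0 : ℝ), charFun (P.map Y) s ≠ 0 :=
      (continuous_charFun (μ := P.map Y)).continuousAt.eventually_ne (by simp)
    exact ((hc.filter_mono nhdsWithin_le_nhds).and
      (self_mem_nhdsWithin : {(0 : ℝ)}ᶜ ∈ 𝓝[≠] (0 : ℝ))).exists
  have hs2 : s ^ 2 ≠ 0 := pow_ne_zero 2 hs0
  have hvr : Tendsto (fun k => (v k : ℝ)) atTop
      (𝓝 (-(2 / s ^ 2) * Real.log ‖charFun (P.map Y) s‖)) := by
    refine Tendsto.congr (fun k => ?_)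
      (((hlim s).norm.log (norm_ne_zero_iff.mpr hs)).const_mul (-(2 / s ^ 2)))
    rw [Complex.norm_real, Real.norm_of_nonneg (Real.exp_pos _).le, Real.log_exp]
    field_simp
  obtain ⟨u, hu⟩ : ∃ u : ℝ≥0, (u : ℝ) = -(2 / s ^ 2) * Real.log ‖charFun (P.map Y) s‖ :=
    ⟨⟨_, ge_of_tendsto' hvr fun k => (v k).2⟩, rfl⟩
  rw [← hu] at hvr
  have hvu : Tendsto v atTop (𝓝 u) := NNReal.tendsto_coe.mp hvr
  refine ⟨u, hvu, hY, Measure.ext_of_charFun (funext fun r => ?_)⟩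
  refine tendsto_nhds_unique (hlim r) ?_
  rw [charFun_gaussianReal_zero]
  have : Continuous fun q : ℝ => ((Real.exp (-(q * r ^ 2 / 2)) : ℝ) : ℂ) := by fun_prop
  exact (this.tendsto _).comp hvr

lemma lintegral_exp_mul_of_hasLaw_gaussianReal {X : Ω → ℝ} {v : ℝ≥0}
    (hX : HasLaw X (gaussianReal 0 v) P) (s : ℝ) :
    ∫⁻ w, ENNReal.ofReal (Real.exp (s * X w)) ∂P = ENNReal.ofReal (Real.exp (v * s ^ 2 / 2)) := by
  have h1 : ∫⁻ w, ENNReal.ofReal (Real.exp (s * X w)) ∂P =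
      ∫⁻ x, ENNReal.ofReal (Real.exp (s * x)) ∂(gaussianReal 0 v) := by
    rw [← hX.map_eq, lintegral_map' (by fun_prop) hX.aemeasurable]
  rw [h1, ← ofReal_integral_eq_lintegral_ofReal (integrable_exp_mul_gaussianReal s)
    (ae_of_all _ fun x => (Real.exp_pos _).le)]
  congr 1
  have := congrFun (mgf_id_gaussianReal (μ := 0) (v := v)) s
  simpa [mgf] using this

/-- Linear combinations of independent standard Gaussian variables are centred Gaussian. -/
lemma exists_hasLaw_gaussianReal_sum [IsProbabilityMeasure P] {a : ℕ → Ω → ℝ}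
    (ha : ∀ j, HasLaw (a j) (gaussianReal 0 1) P) (hindep : iIndepFun a P) (b : ℕ → ℝ) (N : ℕ) :
    ∃ v, HasLaw (fun w => ∑ j ∈ Finset.range N, b j * a j w) (gaussianReal 0 v) P := by
  have hlaw := fun j => gaussianReal_const_mul (ha j) (b j)
  have hind : iIndepFun (fun j w => b j * a j w) P :=
    hindep.comp (fun j r => b j * r) fun j => by fun_prop
  have hm : ∀ j, AEMeasurable (fun w => b j * a j w) P := fun j => (hlaw j).aemeasurable
  refine ⟨∑ j ∈ Finset.range N, NNReal.mk (b j ^ 2) (sq_nonneg _), by fun_prop,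
    Measure.ext_of_charFun ?_⟩
  rw [iIndepFun.charFun_map_fun_finsetSum_eq_prod (fun j _ => hm j) (hind.restrict _)]
  ext s
  simp_rw [Finset.prod_apply, (hlaw _).map_eq, mul_zero, charFun_gaussianReal_zero]
  rw [← Complex.ofReal_prod, ← Real.exp_sum]
  push_cast
  simp [Finset.sum_mul, Finset.sum_div]

end Gaussian

/-! ### Variance, measurability and exponential moments of the field -/

section Field

variable {Ω : Type*} [MeasurableSpace Ω] {P : Measure Ω} {M : Type*}

/-- The values of the random series are centred Gaussian. -/
lemma IsRandomSeries.exists_hasLaw [IsProbabilityMeasure P] {a : ℕ → Ω → ℝ} {c : ℕ → ℝ}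
    {φ : ℕ → M → ℝ} {f : Ω → M → ℝ}
    (hf : IsRandomSeries P a c φ f) (ha : ∀ j, 1 ≤ j → HasLaw (a j) (gaussianReal 0 1) P)
    (hindep : iIndepFun (fun j => a (j + 1)) P) (x : M) :
    ∃ v, HasLaw (fun w => f w x) (gaussianReal 0 v) P := by
  -- The coefficients absorb the minus sign and the shift from indices `1, …, N` to `0, …, N - 1`.
  choose v hv using exists_hasLaw_gaussianReal_sum (fun j => ha (j + 1) (by lia)) hindep
    (fun j => -(c (j + 1) * φ (j + 1) x))
  obtain ⟨u, -, hu⟩ := exists_hasLaw_gaussianReal_of_tendsto hv (Y := fun w => f w x) <| by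
    filter_upwards [hf x] with w hw
    refine hw.congr fun N => ?_
    rw [Finset.range_eq_Ico, Finset.sum_Ico_add' (fun j => -(c j * φ j x) * a j w) 0 N 1,
      ← Finset.sum_neg_distrib]
    refine Finset.sum_congr (by ext; simp) fun j _ => by ring
  exact ⟨u, hu⟩

/-- The variance of an almost surely continuous Gaussian field on a compact space is bounded. -/
lemma exists_variance_bound [IsProbabilityMeasure P] [TopologicalSpace M] [CompactSpace M]
    [FirstCountableTopology M] {f : Ω → M → ℝ}
    {v : M → ℝ≥0} (hv : ∀ x, HasLaw (fun w => f w x) (gaussianReal 0 (v x)) P)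
    (hfc : ∀ᵐ w ∂P, Continuous (f w)) : ∃ K, ∀ x, v x ≤ K := by
  have hcont : Continuous v := by
    refine SeqContinuous.continuous fun x p hx => ?_
    obtain ⟨u, hu, hlaw⟩ := exists_hasLaw_gaussianReal_of_tendsto (fun k => hv (x k))
      (Y := fun w => f w p) (by
        filter_upwards [hfc] with w hw using (hw.tendsto p).comp hx)
    have : u = v p := (gaussianReal_ext_iff.mp (hlaw.map_eq.symm.trans (hv p).map_eq)).2
    exact this ▸ hu
  obtain ⟨K, hK⟩ := (isCompact_range hcont).bddAbove
  exact ⟨K, fun x => hK ⟨x, rfl⟩⟩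

/-- An almost surely continuous field with almost everywhere measurable values has a jointly
measurable modification. -/
lemma exists_measurable_modification [TopologicalSpace M]
    [TopologicalSpace.MetrizableSpace M] [SecondCountableTopology M] [MeasurableSpace M]
    [BorelSpace M] {f : Ω → M → ℝ}
    (hm : ∀ x, AEMeasurable (fun w => f w x) P) (hfc : ∀ᵐ w ∂P, Continuous (f w)) :
    ∃ h : Ω → M → ℝ, Measurable (Function.uncurry h) ∧ ∀ᵐ w ∂P, f w = h w := by
  classical
  obtain ⟨D, hDc, hD⟩ := TopologicalSpace.exists_countable_dense M
  have hgood : ∀ᵐ w ∂P, Continuous (f w) ∧ ∀ d ∈ D, f w d = (hm d).mk _ w :=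
    hfc.and ((ae_ball_iff hDc).mpr fun d _ => (hm d).ae_eq_mk)
  obtain ⟨A, hA, hAm, hA0⟩ := exists_measurable_superset_of_null (ae_iff.mp hgood)
  have hAc : ∀ w ∉ A, Continuous (f w) ∧ ∀ d ∈ D, f w d = (hm d).mk _ w := fun w hw => by
    by_contra hcon
    exact hw (hA hcon)
  -- Zeroing the field on the measurable null set `A` makes every path continuous. Measurability at
  -- a point of `D` then passes to all points by limits, and continuity in `x` with measurability in
  -- `w` gives joint measurability.
  let h : Ω → M → ℝ := fun w => if w ∈ A then 0 else f w
  have hc : ∀ w, Continuous (h w) := fun w => by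
    by_cases hw : w ∈ A
    · simp only [h, if_pos hw]; exact continuous_zero
    · simpa only [h, if_neg hw] using (hAc w hw).1
  have hdm : ∀ d ∈ D, Measurable fun w => h w d := fun d hd => by
    have : (fun w => h w d) = A.piecewise (fun _ => (0 : ℝ)) ((hm d).mk _) := by
      ext w
      by_cases hw : w ∈ A
      · simp [h, hw]
      · simp [h, hw, (hAc w hw).2 d hd]
    rw [this]
    exact Measurable.piecewise hAm measurable_const (hm d).measurable_mk
  have hxm : ∀ x, Measurable fun w => h w x := fun x => by
    obtain ⟨d, hdD, hdx⟩ := mem_closure_iff_seq_limit.mp (hD x)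
    exact measurable_of_tendsto_metrizable (fun k => hdm (d k) (hdD k))
      (tendsto_pi_nhds.mpr fun w => ((hc w).tendsto x).comp hdx)
  refine ⟨h, ?_, ?_⟩
  · exact (measurable_uncurry_of_continuous_of_measurable (u := fun x w => h w x) hc hxm).comp
      measurable_swap
  · filter_upwards [compl_mem_ae_iff.mpr hA0] with w hw
    simp only [h, if_neg hw]

variable [IsProbabilityMeasure P] [MeasurableSpace M] {μ : Measure M} [IsFiniteMeasure μ]

/-- After Tonelli, the inner integral is the Gaussian moment generating function, bounded uniformly
in `x` because the variances are. -/
lemma lintegral_lintegral_exp_lt_top {h : Ω → M → ℝ} (hm : Measurable (Function.uncurry h))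
    {v : M → ℝ≥0} (hv : ∀ x, HasLaw (fun w => h w x) (gaussianReal 0 (v x)) P) {K : ℝ≥0}
    (hK : ∀ x, v x ≤ K) (s : ℝ) :
    ∫⁻ w, ∫⁻ x, ENNReal.ofReal (Real.exp (s * h w x)) ∂μ ∂P < ⊤ := by
  have hm' : Measurable fun p : Ω × M => h p.1 p.2 := hm
  rw [lintegral_lintegral_swap (by simp only [Function.uncurry_def]; fun_prop)]
  simp_rw [lintegral_exp_mul_of_hasLaw_gaussianReal (hv _)]
  calc ∫⁻ x, ENNReal.ofReal (Real.exp (v x * s ^ 2 / 2)) ∂μ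
      ≤ ∫⁻ _, ENNReal.ofReal (Real.exp (K * s ^ 2 / 2)) ∂μ := by
        refine lintegral_mono fun x => ?_
        have : (v x : ℝ) ≤ K := hK x
        gcongr
    _ < ⊤ := by
        rw [lintegral_const]
        exact ENNReal.mul_lt_top ENNReal.ofReal_lt_top (measure_lt_top _ _)

lemma tendsto_lintegral_lintegral_exp {h : Ω → M → ℝ} (hm : Measurable (Function.uncurry h))
    (hfin : ∀ s : ℝ, ∫⁻ w, ∫⁻ x, ENNReal.ofReal (Real.exp (s * h w x)) ∂μ ∂P < ⊤) :
    Tendsto (fun s : ℝ => ∫⁻ w, ∫⁻ x, ENNReal.ofReal (Real.exp (s * h w x)) ∂μ ∂P)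
      (𝓝 0) (𝓝 (μ Set.univ)) := by
  have hm' : Measurable fun p : Ω × M => h p.1 p.2 := hm
  have hprod : ∀ s : ℝ, ∫⁻ w, ∫⁻ x, ENNReal.ofReal (Real.exp (s * h w x)) ∂μ ∂P =
      ∫⁻ p, ENNReal.ofReal (Real.exp (s * h p.1 p.2)) ∂(P.prod μ) := fun s => by
    rw [lintegral_prod _ (by fun_prop)]
  have hone : μ Set.univ = ∫⁻ _, 1 ∂(P.prod μ) := by
    simp [Measure.prod_apply MeasurableSet.univ]
  simp_rw [hprod] at hfin ⊢
  rw [hone]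
  -- For `|s| ≤ 1`, `e^{sh} ≤ e^h + e^{-h}`, whichever the sign of `h`; the bound is integrable by
  -- `hfin` at `1` and `-1`.
  refine tendsto_lintegral_filter_of_dominated_convergence
    (fun p => ENNReal.ofReal (Real.exp (1 * h p.1 p.2)) +
      ENNReal.ofReal (Real.exp (-1 * h p.1 p.2))) ?_ ?_ ?_ ?_
  · exact Eventually.of_forall fun s => by fun_prop
  · filter_upwards [Icc_mem_nhds (show (-1 : ℝ) < 0 by norm_num) one_pos] with s hs
    refine ae_of_all _ fun p => ?_
    rcases le_total 0 (h p.1 p.2) with h0 | h0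
    · refine le_add_right (ENNReal.ofReal_le_ofReal (Real.exp_le_exp.mpr ?_))
      exact mul_le_mul_of_nonneg_right hs.2 h0
    · refine le_add_left (ENNReal.ofReal_le_ofReal (Real.exp_le_exp.mpr ?_))
      exact mul_le_mul_of_nonpos_right hs.1 h0
  · rw [lintegral_add_left (by fun_prop)]
    exact (ENNReal.add_lt_top.mpr ⟨hfin 1, hfin (-1)⟩).ne
  · refine ae_of_all _ fun p => ?_
    have : Continuous fun s : ℝ => ENNReal.ofReal (Real.exp (s * h p.1 p.2)) :=
      ENNReal.continuous_ofReal.comp (by fun_prop)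
    simpa using this.tendsto 0

end Field

/-! ### Riemannian volume in charts and under conformal change -/

section Volume

variable {n : ℕ} {M : Type*} [TopologicalSpace M] [ChartedSpace (Eucl n) M]

lemma gram_conformal (g : RMetric n M) (u : M → ℝ) (p : M) (y : Eucl n) :
    gram (conformal g u) p y = Real.exp (u ((chartAt (Eucl n) p).symm y)) • gram g p y := by
  ext i j
  simp [gram, conformal]

lemma sqrt_det_gram_conformal (g : RMetric n M) (u : M → ℝ) (p : M) (y : Eucl n) :
    √(gram (conformal g u) p y).det =
      √(gram g p y).det * Real.exp (n / 2 * u ((chartAt (Eucl n) p).symm y)) := by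
  rw [gram_conformal, Matrix.det_smul, Fintype.card_fin, ← Real.exp_nat_mul,
    Real.sqrt_mul (Real.exp_pos _).le, mul_comm]
  congr 1
  rw [Real.sqrt_eq_iff_mul_self_eq (Real.exp_pos _).le (Real.exp_pos _).le, ← Real.exp_add]
  congr 1
  ring

variable [IsManifold (𝓡 n) ∞ M]

/-- The field `∂ᵢ` is the tangent map of the inverse chart, which is `C¹`, applied to a constant
vector field. -/
lemma continuousOn_coordVec (p : M) (i : Fin n) :
    ContinuousOn (fun y => (⟨(chartAt (Eucl n) p).symm y, coordVec p y i⟩ : TangentBundle (𝓡 n) M))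
      (chartAt (Eucl n) p).target := by
  have : IsManifold (𝓡 n) 1 M := IsManifold.of_le (n := ∞) (by norm_num)
  have ho := (chartAt (Eucl n) p).open_target
  have hs : ContMDiffOn 𝓘(ℝ, Eucl n) (𝓡 n) 1 (chartAt (Eucl n) p).symm
    (chartAt (Eucl n) p).target := contMDiffOn_chart_symm
  have ht := hs.continuousOn_tangentMapWithin le_rfl ho.uniqueMDiffOn
  have hv : Continuous fun y : Eucl n =>
      (⟨y, EuclideanSpace.single i (1 : ℝ)⟩ : TangentBundle 𝓘(ℝ, Eucl n) (Eucl n)) :=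
    (tangentBundleModelSpaceHomeomorph 𝓘(ℝ, Eucl n)).symm.continuous.comp
      (continuous_id.prodMk continuous_const)
  refine (ht.comp hv.continuousOn fun y hy => hy).congr fun y hy => ?_
  simp only [Function.comp_apply, tangentMapWithin, coordVec, mfderivWithin_of_isOpen ho hy]

lemma continuousOn_gram (g : SmoothMetric n M) (p : M) :
    ContinuousOn (gram g.toRMetric p) (chartAt (Eucl n) p).target := by
  have : IsManifold (𝓡 n) 1 M := IsManifold.of_le (n := ∞) (by norm_num)
  refine continuousOn_pi.mpr fun i => continuousOn_pi.mpr fun j => ?_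
  let _ : RiemannianBundle (fun x : M => TangentSpace (𝓡 n) x) := ⟨g.toRMetric⟩
  have : IsContinuousRiemannianBundle (Eucl n) (fun x : M => TangentSpace (𝓡 n) x) :=
    ⟨g.inner, g.contMDiff.continuous, fun _ _ _ => rfl⟩
  exact ContinuousOn.inner_bundle (continuousOn_coordVec p i) (continuousOn_coordVec p j)

lemma continuousOn_sqrt_det_gram (g : SmoothMetric n M) (p : M) :
    ContinuousOn (fun y => √(gram g.toRMetric p y).det) (chartAt (Eucl n) p).target :=
  Real.continuous_sqrt.comp_continuousOn <|
    (continuous_id.matrix_det (n := Fin n) (R := ℝ)).comp_continuousOn (continuousOn_gram g p)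

variable [CompactSpace M] [T2Space M]

lemma tsupport_chartPartition_subset (p : M) :
    tsupport (chartPartition n M p) ⊆ (chartAt (Eucl n) p).source :=
  (SmoothPartitionOfUnity.exists_isSubordinate_chartAt_source (𝓡 n) M).choose_spec p

lemma finite_support_chartPartition :
    {p : M | (Function.support (chartPartition n M p)).Nonempty}.Finite :=
  (chartPartition n M).locallyFinite.finite_nonempty_of_compact

lemma continuousOn_chart_density (g : SmoothMetric n M) (p : M) :
    ContinuousOn (fun y => chartPartition n M p ((chartAt (Eucl n) p).symm y) *
      √(gram g.toRMetric p y).det) (chartAt (Eucl n) p).target :=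
  ((chartPartition n M p).contMDiff.continuous.comp_continuousOn
    (chartAt (Eucl n) p).continuousOn_symm).mul (continuousOn_sqrt_det_gram g p)

lemma aemeasurable_chart_density (g : SmoothMetric n M) (p : M) :
    AEMeasurable (fun y => ENNReal.ofReal (chartPartition n M p ((chartAt (Eucl n) p).symm y) *
      √(gram g.toRMetric p y).det)) (volume.restrict (chartAt (Eucl n) p).target) :=
  ((continuousOn_chart_density g p).aemeasurable
    (chartAt (Eucl n) p).open_target.measurableSet).ennreal_ofReal

variable [MeasurableSpace M] [BorelSpace M]

/-- Without any regularity assumption on the metric, total volume is a sum over charts. -/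
lemma vol_univ (g : RMetric n M) : vol g Set.univ =
    ∑' p : M, ∫⁻ y in (chartAt (Eucl n) p).target,
      ENNReal.ofReal (chartPartition n M p ((chartAt (Eucl n) p).symm y) * √(gram g p y).det) := by
  rw [vol, Measure.sum_apply _ MeasurableSet.univ]
  refine tsum_congr fun p => ?_
  have hs : AEMeasurable (chartAt (Eucl n) p).symm
      ((volume : Measure (Eucl n)).restrict (chartAt (Eucl n) p).target) :=
    (chartAt (Eucl n) p).continuousOn_symm.aemeasurable
      (chartAt (Eucl n) p).open_target.measurableSet
  -- Only the whole space is measured, so the density itself need not be measurable.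
  rw [Measure.map_apply_of_aemeasurable
    (hs.mono_ac (withDensity_absolutelyContinuous _ _)) MeasurableSet.univ, Set.preimage_univ,
    withDensity_apply _ MeasurableSet.univ, Measure.restrict_univ]

/-- The integral of a function against the Riemannian volume, in charts. -/
lemma lintegral_vol (g : SmoothMetric n M) {h : M → ENNReal} (hh : Measurable h) :
    ∫⁻ x, h x ∂vol g.toRMetric =
      ∑' p : M, ∫⁻ y in (chartAt (Eucl n) p).target,
        ENNReal.ofReal (chartPartition n M p ((chartAt (Eucl n) p).symm y) *
          √(gram g.toRMetric p y).det) * h ((chartAt (Eucl n) p).symm y) := by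
  rw [vol, lintegral_sum_measure]
  refine tsum_congr fun p => ?_
  have hs : AEMeasurable (chartAt (Eucl n) p).symm
      ((volume : Measure (Eucl n)).restrict (chartAt (Eucl n) p).target) :=
    (chartAt (Eucl n) p).continuousOn_symm.aemeasurable
      (chartAt (Eucl n) p).open_target.measurableSet
  rw [lintegral_map' hh.aemeasurable (hs.mono_ac (withDensity_absolutelyContinuous _ _)),
    lintegral_withDensity_eq_lintegral_mul₀ (aemeasurable_chart_density g p)
      (g := fun y => h ((chartAt (Eucl n) p).symm y)) (hh.comp_aemeasurable hs)]
  rfl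

/-- The volume of a conformal metric `e ^ u • g` is the integral of `e ^ (n u / 2)`. -/
lemma vol_conformal_univ (g : SmoothMetric n M) {u : M → ℝ} (hu : Measurable u) :
    vol (conformal g.toRMetric u) Set.univ =
      ∫⁻ x, ENNReal.ofReal (Real.exp (n / 2 * u x)) ∂vol g.toRMetric := by
  rw [vol_univ, lintegral_vol g (by fun_prop)]
  refine tsum_congr fun p => lintegral_congr fun y => ?_
  rw [sqrt_det_gram_conformal, ← mul_assoc, ENNReal.ofReal_mul]
  exact mul_nonneg ((chartPartition n M).nonneg _ _) (Real.sqrt_nonneg _)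

/-- By compactness only finitely many partition functions are nonzero. Each has compact support
inside its chart domain, so its density, continuous on the chart target, is bounded on the compact
image of that support and vanishes on the rest of the target. -/
lemma vol_univ_lt_top (g : SmoothMetric n M) : vol g.toRMetric Set.univ < ⊤ := by
  rw [vol_univ, tsum_eq_sum (s := (finite_support_chartPartition (n := n) (M := M)).toFinset)]
  · refine ENNReal.sum_lt_top.mpr fun p _ => ?_
    set e := chartAt (Eucl n) p
    set K : Set (Eucl n) := e '' tsupport (chartPartition n M p)
    have hsub := tsupport_chartPartition_subset (n := n) p
    have hK : IsCompact K :=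
      (isClosed_tsupport _).isCompact.image_of_continuousOn (e.continuousOn.mono hsub)
    have hKt : K ⊆ e.target := by
      rintro _ ⟨x, hx, rfl⟩
      exact e.map_source (hsub hx)
    obtain ⟨C, hC⟩ := (hK.bddAbove_image ((continuousOn_chart_density g p).mono hKt))
    calc _ ≤ ∫⁻ y in e.target, K.indicator (fun _ => ENNReal.ofReal C) y := by
          refine setLIntegral_mono' e.open_target.measurableSet fun y hy => ?_
          by_cases hyK : y ∈ K
          · rw [Set.indicator_of_mem hyK]
            exact ENNReal.ofReal_le_ofReal (hC ⟨y, hyK, rfl⟩)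
          · have : chartPartition n M p (e.symm y) = 0 := by
              refine image_eq_zero_of_notMem_tsupport fun hmem => hyK ?_
              exact ⟨_, hmem, e.right_inv hy⟩
            simp [this]
      _ ≤ ∫⁻ y, K.indicator (fun _ => ENNReal.ofReal C) y := setLIntegral_le_lintegral _ _
      _ = ENNReal.ofReal C * volume K := by
          rw [lintegral_indicator hK.measurableSet, setLIntegral_const]
      _ < ⊤ := ENNReal.mul_lt_top ENNReal.ofReal_lt_top hK.measure_lt_top
  · intro p hp
    have : ∀ x, chartPartition n M p x = 0 := by
      simpa [Set.nonempty_def] using hp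
    simp [this]

end Volume

end RandomMetric

open RandomMetric in
/-- As `t → 0`, the expected volume of the random metric `e^{tf} g₀` tends to the volume of `g₀`.
All the volumes are finite in expectation. -/
theorem mainTheorem11 {n : ℕ} (hn : 2 ≤ n)
    {M : Type*} [TopologicalSpace M] [ChartedSpace (Eucl n) M] [IsManifold (𝓡 n) ∞ M]
    [CompactSpace M] [T2Space M] [MeasurableSpace M] [BorelSpace M]
    (g₀ : SmoothMetric n M)
    (lam : ℕ → ℝ) (φ : ℕ → M → ℝ) (hφ : IsEigenbasis g₀.toRMetric lam φ)
    (F : ℝ → ℝ) (hF : ∃ T, AntitoneOn F (Set.Ici T)) (hF0 : Tendsto F atTop (𝓝 0))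
    (c : ℕ → ℝ) (hc : ∀ j, 1 ≤ j → c j = F (lam j)) (hcpos : ∀ j, 1 ≤ j → 0 < c j)
    {Ω : Type*} [MeasurableSpace Ω] (P : Measure Ω) [IsProbabilityMeasure P]
    (a : ℕ → Ω → ℝ) (ha : ∀ j, 1 ≤ j → HasLaw (a j) (gaussianReal 0 1) P)
    (hindep : iIndepFun (fun j => a (j + 1)) P)
    (f : Ω → M → ℝ) (hf : IsRandomSeries P a c φ f) (hfc : ∀ᵐ w ∂P, Continuous (f w)) :
    vol g₀.toRMetric Set.univ < ⊤ ∧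
    (∀ t : ℝ, AEMeasurable
        (fun w => vol (conformal g₀.toRMetric (fun x => t * f w x)) Set.univ) P ∧
      ∫⁻ w, vol (conformal g₀.toRMetric (fun x => t * f w x)) Set.univ ∂P < ⊤) ∧
    Tendsto (fun t : ℝ =>
        ∫⁻ w, vol (conformal g₀.toRMetric (fun x => t * f w x)) Set.univ ∂P)
      (𝓝 0) (𝓝 (vol g₀.toRMetric Set.univ)) := by
  have : SecondCountableTopology M := ChartedSpace.secondCountable_of_sigmaCompact (Eucl n) M
  have : TopologicalSpace.MetrizableSpace M :=
    TopologicalSpace.metrizableSpace_of_t3_secondCountable M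
  have : IsFiniteMeasure (vol g₀.toRMetric) := ⟨vol_univ_lt_top g₀⟩
  choose v hv using hf.exists_hasLaw ha hindep
  obtain ⟨K, hK⟩ := exists_variance_bound hv hfc
  obtain ⟨h, hm, hfh⟩ := exists_measurable_modification (fun x => (hv x).aemeasurable) hfc
  -- The jointly measurable modification has the same one-point laws, so the variance bound carries
  -- over to it.
  have hlaw : ∀ x, HasLaw (fun w => h w x) (gaussianReal 0 (v x)) P := fun x =>
    (hv x).congr <| by filter_upwards [hfh] with w hw using by rw [hw]
  have hfin := lintegral_lintegral_exp_lt_top (μ := vol g₀.toRMetric) hm hlaw hK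
  have hvol : ∀ t : ℝ, (fun w => vol (conformal g₀.toRMetric (fun x => t * f w x)) Set.univ) =ᵐ[P]
      fun w => ∫⁻ x, ENNReal.ofReal (Real.exp (n / 2 * t * h w x)) ∂vol g₀.toRMetric := fun t => by
    filter_upwards [hfh, hfc] with w hw hc
    rw [vol_conformal_univ g₀ (by have := hc.measurable; fun_prop), hw]
    simp_rw [mul_assoc]
  refine ⟨vol_univ_lt_top g₀, fun t => ⟨?_, ?_⟩, ?_⟩
  · refine AEMeasurable.congr (Measurable.aemeasurable ?_) (hvol t).symm
    have hm' : Measurable fun p : Ω × M => h p.1 p.2 := hm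
    exact Measurable.lintegral_prod_right' (ν := vol g₀.toRMetric)
      (f := fun p : Ω × M => ENNReal.ofReal (Real.exp (n / 2 * t * h p.1 p.2))) (by fun_prop)
  · rw [lintegral_congr_ae (hvol t)]
    exact hfin _
  · simp_rw [lintegral_congr_ae (hvol _)]
    have h0 : Tendsto (fun t : ℝ => (n : ℝ) / 2 * t) (𝓝 0) (𝓝 0) := by
      simpa using (continuous_const_mul ((n : ℝ) / 2)).tendsto 0
    exact (tendsto_lintegral_lintegral_exp hm hfin).comp h0
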